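/- **Setting.** Fix $0<A<B<1$ and a probability space $(\Omega,\mathcal P)$. Let $(a_n,b_n)_{n\ge1}$ be i.i.d. random pairs with $A\le\min(a_n,b_n)$ and $a_n+b_n\le B$, and let $(p_n)_{n\ge1}$ be i.i.d. random variables with values in $[0,1]$, the sequence $(p_n)$ being independent of the sequence $((a_n,b_n))$, such that $\mathbb E(p_1^{-t})<\infty$ and $\mathbb E((1-p_1)^{-t})<\infty$ for some $t>0$. For each $\omega$, the only Moran interval of step $0$ is $[0,1]$; a Moran interval $I$ of step $n-1$ has two children of step $n$: the closed subinterval of length $a_n(\omega)|I|$ with the same left end point (left child) and the closed subinterval of length $b_n(\omega)|I|$ with the same right end point (right child). Let $\mu_\omega$ be the Borel probability measure on $[0,1]$ such that every Moran interval $I$ of step $n-1$ satisfies $\mu_\omega(\text{left child of }I)=p_n(\omega)\mu_\omega(I)$ and $\mu_\omega(\text{right child of }I)=(1-p_n(\omega))\mu_\omega(I)$. **Dimensions.** A dimension function is a map $\Phi:(0,1)\to\mathbb R$ for which, near $0$, $\Phi\ge 0$ and $t^{1+\Phi(t)}$ decreases (not necessarily strictly) to $0$ as $t$ decreases to $0$.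 It is called large if, near $0$, $\Phi(t)=H(t)\,\frac{\log|\log t|}{|\log t|}$ with $H(t)\to\infty$ as $t\to0^+$. The upper $\Phi$-dimension $\overline{\dim}_\Phi\mu\in[-\infty,\infty]$ of a measure $\mu$ is the infimum of all real $d$ for which there are $C_1,C_2>0$ such that $$\frac{\mu(B(x,R))}{\mu(B(x,r))}\le C_2\Big(\frac Rr\Big)^d\quad\text{for all }x\in\operatorname{supp}\mu\text{ and all }0<r<R^{1+\Phi(R)}\le R\le C_1,\ R<1,$$ where $B(x,r)$ is the open ball. **The function $G$.** For $\theta\ge0$ put $Y(\theta)=\log p_1$ and $Z(\theta)=\log a_1$ on the event $p_1\le \frac{a_1^\theta}{a_1^\theta+b_1^\theta}$, put $Y(\theta)=\log(1-p_1)$ and $Z(\theta)=\log b_1$ on the complementary event, and let $G(\theta)=\mathbb E(Y(\theta))/\mathbb E(Z(\theta))$. **Theorem.** Suppose that $\mathbb E(\log p_1)$ and $\mathbb E(\log(1-p_1))$ are finite and that $G$ is continuous on $[0,\infty)$. Then there is a unique $\alpha\ge0$ such that $G(\alpha)=\alpha$ and $G(\psi)<\psi$ for all $\psi>\alpha$.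 For this $\alpha$ there is a set $\Gamma\subseteq\Omega$ of full measure such that $\overline{\dim}_\Phi\mu_\omega=\alpha$ for all $\omega\in\Gamma$ and all large dimension functions $\Phi$. -/

import Mathlib

open MeasureTheory ProbabilityTheory Filter Topology Set
open scoped ENNReal

noncomputable section

/-! ### Dimension functions and the upper `Φ`-dimension -/

/-- Dimension functions: near `0` the function `Φ` is non-negative, and `t ^ (1 + Φ t)` decreases
to `0` as `t` decreases to `0`. Only the values of `Φ` on `(0, 1)` near `0` are relevant. -/
structure IsDimensionFunction (Φ : ℝ → ℝ) : Prop where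
  exists_nonneg_monotone : ∃ δ ∈ Ioc (0 : ℝ) 1, (∀ t ∈ Ioo 0 δ, 0 ≤ Φ t) ∧
    MonotoneOn (fun t => t ^ (1 + Φ t)) (Ioo 0 δ)
  tendsto_zero : Tendsto (fun t => t ^ (1 + Φ t)) (𝓝[>] 0) (𝓝 0)

/-- Large dimension functions: `Φ(t) = H(t) log |log t| / |log t|` with `H(t) → ∞`, as `t → 0`. -/
structure IsLargeDimensionFunction (Φ : ℝ → ℝ) : Prop extends IsDimensionFunction Φ where
  exists_factor : ∃ H : ℝ → ℝ, Tendsto H (𝓝[>] 0) atTop ∧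
    ∀ᶠ t in 𝓝[>] 0, Φ t = H t * (Real.log |Real.log t| / |Real.log t|)

/-- The upper `Φ`-dimension of a measure, as an infimum of real exponents `d` taken in the
extended reals (so that it is `⊤` if there is no admissible exponent). -/
def upperPhiDim {X : Type*} [PseudoMetricSpace X] [MeasurableSpace X]
    (Φ : ℝ → ℝ) (μ : Measure X) : EReal :=
  sInf {D : EReal | ∃ d : ℝ, D = d ∧ ∃ C₁ > 0, ∃ C₂ > 0, ∀ r R : ℝ,
    0 < r → r < R ^ (1 + Φ R) → R ^ (1 + Φ R) ≤ R → R ≤ C₁ → R < 1 → ∀ x ∈ μ.support,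
      μ (Metric.ball x R) / μ (Metric.ball x r) ≤ ENNReal.ofReal (C₂ * (R / r) ^ d)}

/-! ### Moran intervals and the Moran measure

Here `a`, `b`, `p` are the sequences of left ratios, right ratios and left probabilities; the entry
with index `n` is the one used in passing from step `n` to step `n + 1`. An infinite word
`σ : ℕ → Bool` picks the left (`false`) or the right (`true`) child at each step. -/

/-- Length of the step `n` Moran interval with address `σ 0, …, σ (n - 1)`. -/
def moranLength (a b : ℕ → ℝ) (σ : ℕ → Bool) : ℕ → ℝ
  | 0 => 1
  | n + 1 => (if σ n then b n else a n) * moranLength a b σ n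

/-- Left end point of the step `n` Moran interval with address `σ 0, …, σ (n - 1)`: a left child
keeps the left end point of its parent, a right child keeps the right end point. -/
def moranLeft (a b : ℕ → ℝ) (σ : ℕ → Bool) : ℕ → ℝ
  | 0 => 0
  | n + 1 => moranLeft a b σ n + if σ n then (1 - b n) * moranLength a b σ n else 0

/-- The step `n` Moran interval with address `σ 0, …, σ (n - 1)`. -/
def moranInterval (a b : ℕ → ℝ) (σ : ℕ → Bool) (n : ℕ) : Set ℝ :=
  Icc (moranLeft a b σ n) (moranLeft a b σ n + moranLength a b σ n)

/-- The point of the Moran set with address `σ`: the limit of the left end points of the nested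
Moran intervals along `σ`. -/
def moranPoint (a b : ℕ → ℝ) (σ : ℕ → Bool) : ℝ := ⨆ n, moranLeft a b σ n

/-- The Moran measure: the image, under the address map, of the product measure on words that
gives the letter `false` (left) in position `n` the probability `p n`. -/
def moranMeasure (a b : ℕ → ℝ) (p : ℕ → unitInterval) : Measure ℝ :=
  (Measure.infinitePi fun n => bernoulliMeasure false true (p n)).map (moranPoint a b)

/-! The measure just built is the one given by the subdivision rule. -/

section Rule

variable {a b : ℕ → ℝ}

theorem measurable_moranPoint : Measurable (moranPoint a b) := by
  have hs : ∀ n, MeasurableSet {σ : ℕ → Bool | σ n = true} := fun n =>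
    measurableSet_eq_fun (measurable_pi_apply n) measurable_const
  have hb : ∀ n, Measurable fun σ : ℕ → Bool => moranLength a b σ n := by
    intro n
    induction n with
    | zero => exact measurable_const
    | succ n ih =>
      exact (Measurable.ite (hs n) measurable_const measurable_const).mul ih
  refine Measurable.iSup fun n => ?_
  induction n with
  | zero => exact measurable_const
  | succ n ih =>
    exact ih.add (Measurable.ite (hs n) (measurable_const.mul (hb n)) measurable_const)

instance isProbabilityMeasure_moranMeasure (p : ℕ → unitInterval) :
    IsProbabilityMeasure (moranMeasure a b p) :=
  Measure.isProbabilityMeasure_map measurable_moranPoint.aemeasurable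

theorem moranLength_pos (ha : ∀ n, 0 < a n) (hb : ∀ n, 0 < b n) (σ : ℕ → Bool) (n : ℕ) :
    0 < moranLength a b σ n := by
  induction n with
  | zero => exact one_pos
  | succ n ih =>
    simp only [moranLength]
    split_ifs
    · exact mul_pos (hb n) ih
    · exact mul_pos (ha n) ih

theorem moranInterval_succ_subset (ha : ∀ n, 0 < a n) (hb : ∀ n, 0 < b n)
    (hab : ∀ n, a n + b n < 1) (σ : ℕ → Bool) (n : ℕ) :
    moranLeft a b σ n ≤ moranLeft a b σ (n + 1) ∧
      moranLeft a b σ (n + 1) + moranLength a b σ (n + 1) ≤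
        moranLeft a b σ n + moranLength a b σ n := by
  have h := moranLength_pos ha hb σ n
  have h1 := ha n
  have h2 := hb n
  have h3 := hab n
  simp only [moranLeft, moranLength]
  split_ifs
  · constructor <;> nlinarith
  · constructor <;> nlinarith

theorem moranPoint_mem (ha : ∀ n, 0 < a n) (hb : ∀ n, 0 < b n)
    (hab : ∀ n, a n + b n < 1) (σ : ℕ → Bool) (n : ℕ) :
    moranPoint a b σ ∈ moranInterval a b σ n := by
  have hmono : Monotone (moranLeft a b σ) :=
    monotone_nat_of_le_succ fun n => (moranInterval_succ_subset ha hb hab σ n).1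
  have hanti : Antitone fun n => moranLeft a b σ n + moranLength a b σ n :=
    antitone_nat_of_succ_le fun n => (moranInterval_succ_subset ha hb hab σ n).2
  have hle : ∀ m n, moranLeft a b σ m ≤ moranLeft a b σ n + moranLength a b σ n := by
    intro m n
    have h1 := hmono (le_max_left m n)
    have h2 := hanti (le_max_right m n)
    have h3 := moranLength_pos ha hb σ (max m n)
    simp only at h2
    linarith
  exact ⟨le_ciSup (f := moranLeft a b σ) ⟨_, forall_mem_range.2 fun m => hle m 0⟩ n,
    ciSup_le fun m => hle m n⟩

theorem moranInterval_congr {σ τ : ℕ → Bool} {n : ℕ} (h : ∀ i < n, τ i = σ i) :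
    moranLeft a b τ n = moranLeft a b σ n ∧ moranLength a b τ n = moranLength a b σ n := by
  induction n with
  | zero => exact ⟨rfl, rfl⟩
  | succ n ih =>
    obtain ⟨h1, h2⟩ := ih fun i hi => h i (by omega)
    simp only [moranLeft, moranLength, h1, h2, h n (by omega), and_self]

theorem moranPoint_mem_iff (ha : ∀ n, 0 < a n) (hb : ∀ n, 0 < b n)
    (hab : ∀ n, a n + b n < 1) (σ τ : ℕ → Bool) (n : ℕ) :
    moranPoint a b τ ∈ moranInterval a b σ n ↔ ∀ i < n, τ i = σ i := by
  constructor
  · induction n with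
    | zero => intro _ i hi; omega
    | succ n ih =>
      intro hx
      have hs := moranInterval_succ_subset ha hb hab σ n
      have hn := ih ⟨hs.1.trans hx.1, hx.2.trans hs.2⟩
      obtain ⟨e1, e2⟩ := moranInterval_congr (a := a) (b := b) hn
      have hy := moranPoint_mem ha hb hab τ (n + 1)
      have hpos := moranLength_pos ha hb σ n
      have h3 := hab n
      have key : τ n = σ n := by
        simp only [moranInterval, moranLeft, moranLength, mem_Icc, e1, e2] at hx hy
        rcases hσ : σ n with _ | _ <;> rcases hτ : τ n with _ | _ <;>
          simp only [hσ, hτ, if_true, if_false, Bool.false_eq_true] at hx hy ⊢ <;> nlinarith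
      intro i hi
      rcases Nat.lt_succ_iff_lt_or_eq.1 hi with h | rfl
      · exact hn i h
      · exact key
  · intro h
    have := moranPoint_mem ha hb hab τ n
    obtain ⟨e1, e2⟩ := moranInterval_congr (a := a) (b := b) h
    simpa only [moranInterval, e1, e2] using this

theorem moranMeasure_moranInterval (ha : ∀ n, 0 < a n) (hb : ∀ n, 0 < b n)
    (hab : ∀ n, a n + b n < 1) (p : ℕ → unitInterval) (σ : ℕ → Bool) (n : ℕ) :
    moranMeasure a b p (moranInterval a b σ n) =
      ∏ i ∈ Finset.range n, ENNReal.ofReal (if σ i then 1 - (p i : ℝ) else p i) := by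
  have hpre : moranPoint a b ⁻¹' moranInterval a b σ n =
      Set.pi (Finset.range n : Set ℕ) fun i => {σ i} := by
    ext τ
    simp [Set.mem_pi, moranPoint_mem_iff ha hb hab]
  rw [moranMeasure, Measure.map_apply measurable_moranPoint (by exact measurableSet_Icc), hpre,
    Measure.infinitePi_pi _ fun i _ => measurableSet_singleton _]
  refine Finset.prod_congr rfl fun i _ => ?_
  rw [← ofReal_measureReal]
  congr 1
  rcases σ i with _ | _
  · simp
  · simp

/-- The unit interval has mass one. -/
theorem moranMeasure_Icc (ha : ∀ n, 0 < a n) (hb : ∀ n, 0 < b n)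
    (hab : ∀ n, a n + b n < 1) (p : ℕ → unitInterval) : moranMeasure a b p (Icc 0 1) = 1 := by
  simpa [moranInterval, moranLeft, moranLength] using
    moranMeasure_moranInterval ha hb hab p (fun _ => false) 0

/-- A left child gets the proportion `p n` of the mass of its step `n` parent, a right child gets
the proportion `1 - p n`. -/
theorem moranMeasure_child (ha : ∀ n, 0 < a n) (hb : ∀ n, 0 < b n)
    (hab : ∀ n, a n + b n < 1) (p : ℕ → unitInterval) (σ : ℕ → Bool) (n : ℕ) :
    moranMeasure a b p (moranInterval a b σ (n + 1)) =
      ENNReal.ofReal (if σ n then 1 - (p n : ℝ) else p n) *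
        moranMeasure a b p (moranInterval a b σ n) := by
  simp only [moranMeasure_moranInterval ha hb hab]
  rw [Finset.prod_range_succ, mul_comm]

end Rule

/-! ### The random model and the function `G` -/

/-- The standing assumptions on the random ratios `(a n, b n)` and the random probabilities `p n`.
(Expectations of negative powers are Lebesgue integrals in `[0, ∞]`, with `0 ^ (-t) = ∞`.) -/
structure IsMoranModel {Ω : Type*} [MeasurableSpace Ω] (P : Measure Ω) (A B : ℝ)
    (a b : ℕ → Ω → ℝ) (p : ℕ → Ω → unitInterval) : Prop where
  A_pos : 0 < A
  A_lt_B : A < B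
  B_lt_one : B < 1
  measurable_a : ∀ n, Measurable (a n)
  measurable_b : ∀ n, Measurable (b n)
  measurable_p : ∀ n, Measurable (p n)
  le_min : ∀ n ω, A ≤ min (a n ω) (b n ω)
  add_le : ∀ n ω, a n ω + b n ω ≤ B
  indep_ab : iIndepFun (fun n ω => (a n ω, b n ω)) P
  identDistrib_ab : ∀ n, IdentDistrib (fun ω => (a n ω, b n ω)) (fun ω => (a 0 ω, b 0 ω)) P P
  indep_p : iIndepFun p P
  identDistrib_p : ∀ n, IdentDistrib (p n) (p 0) P P
  indep_ab_p : IndepFun (fun ω n => (a n ω, b n ω)) (fun ω n => p n ω) P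
  moment_p : ∃ t : ℝ, 0 < t ∧ ∫⁻ ω, ENNReal.ofReal (p 0 ω : ℝ) ^ (-t) ∂P < ∞
  moment_one_sub_p : ∃ t : ℝ, 0 < t ∧ ∫⁻ ω, ENNReal.ofReal (1 - (p 0 ω : ℝ)) ^ (-t) ∂P < ∞

/-- `Y(θ)` as a function of the values `x`, `y`, `q` of `a`, `b`, `p`. -/
def moranY (θ x y q : ℝ) : ℝ :=
  if q ≤ x ^ θ / (x ^ θ + y ^ θ) then Real.log q else Real.log (1 - q)

/-- `Z(θ)` as a function of the values `x`, `y`, `q` of `a`, `b`, `p`. -/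
def moranZ (θ x y q : ℝ) : ℝ :=
  if q ≤ x ^ θ / (x ^ θ + y ^ θ) then Real.log x else Real.log y

/-- `G(θ) = 𝔼 Y₁(θ) / 𝔼 Z₁(θ)`. -/
def moranG {Ω : Type*} [MeasurableSpace Ω] (P : Measure Ω)
    (a b : ℕ → Ω → ℝ) (p : ℕ → Ω → unitInterval) (θ : ℝ) : ℝ :=
  (∫ ω, moranY θ (a 0 ω) (b 0 ω) (p 0 ω) ∂P) / ∫ ω, moranZ θ (a 0 ω) (b 0 ω) (p 0 ω) ∂P

end

/-! Fix `θ` and follow `log (mass) - θ * log (length)` down a branch. One subdivision step adds one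
of two increments; `moranIncr` is the smaller, and its sums over blocks of steps bound the change
along every branch from below. Along the greedy branch these bounds are attained.

Let `m θ` be the mean of `moranIncr θ` for one step. Both branches of the minimum have slope in `θ`
between `-log B` and `-log A`, so `m` is continuous and strictly increasing; since `m 0 ≤ 0`, it has
a unique zero `α ≥ 0`. The threshold in `moranY` and `moranZ` is the one that selects the smaller
increment, hence `G(θ) - θ = m θ / 𝔼 Z(θ)` with `𝔼 Z(θ) < 0`. So `G(α) = α` characterises this zero,
and `G(ψ) < ψ` beyond it.

For `θ < α` the law of large numbers sends the sums to `-∞`, so the greedy point alone forces the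
dimension up to `θ` (`le_upperPhiDim`). For `θ > α` the negative moments of `p` and `1 - p` yield a
Chernoff bound, and Borel–Cantelli makes all sums over blocks of length at least `K log n` after a
late step `n` non-negative (`ae_exists_forall_sum_Ico_nonneg`). A large `Φ` is what makes the scales
`R` and `r` at least that many steps apart, so `θ` is admissible (`upperPhiDim_le`). Rational `θ`
suffice, which gives one null set for all `Φ`. -/

/-! ### Moran intervals, masses and balls for fixed ratios and probabilities. -/

/-- The step `n` proportions lie above `A`, and their sum lies below `B < 1`. -/
structure IsMoranRatios (A B : ℝ) (a b : ℕ → ℝ) : Prop where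
  A_pos : 0 < A
  B_lt_one : B < 1
  le_a : ∀ n, A ≤ a n
  le_b : ∀ n, A ≤ b n
  add_le : ∀ n, a n + b n ≤ B

/-- Mass of the step `n` Moran interval with address `σ 0, …, σ (n - 1)`. -/
noncomputable def moranMass (p : ℕ → unitInterval) (σ : ℕ → Bool) (n : ℕ) : ℝ :=
  ∏ i ∈ Finset.range n, if σ i then 1 - (p i : ℝ) else p i

/-- The smaller of the two increments of `log (mass) - θ * log (length)` in a subdivision step. -/
noncomputable def moranIncr (θ x y q : ℝ) : ℝ :=
  min (Real.log q - θ * Real.log x) (Real.log (1 - q) - θ * Real.log y)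

theorem moranMass_pos {p : ℕ → unitInterval} (hp : ∀ n, (p n : ℝ) ∈ Ioo (0 : ℝ) 1)
    (σ : ℕ → Bool) (n : ℕ) : 0 < moranMass p σ n := by
  refine Finset.prod_pos fun i _ => ?_
  split_ifs
  · exact sub_pos.2 (hp i).2
  · exact (hp i).1

/-- Moran points are dense in the support. -/
theorem exists_moranPoint_near {a b : ℕ → ℝ} {p : ℕ → unitInterval} {x : ℝ}
    (hx : x ∈ (moranMeasure a b p).support) {ε : ℝ} (hε : 0 < ε) :
    ∃ σ, dist (moranPoint a b σ) x < ε := by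
  rw [Measure.mem_support_iff_forall] at hx
  have h1 := hx _ (Metric.ball_mem_nhds x hε)
  rw [moranMeasure, Measure.map_apply measurable_moranPoint measurableSet_ball] at h1
  exact nonempty_of_measure_ne_zero h1.ne'

namespace IsMoranRatios

variable {A B : ℝ} {a b : ℕ → ℝ} {p : ℕ → unitInterval}

theorem a_pos (h : IsMoranRatios A B a b) (n : ℕ) : 0 < a n := h.A_pos.trans_le (h.le_a n)

theorem b_pos (h : IsMoranRatios A B a b) (n : ℕ) : 0 < b n := h.A_pos.trans_le (h.le_b n)

theorem add_lt_one (h : IsMoranRatios A B a b) (n : ℕ) :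
    a n + b n < 1 := (h.add_le n).trans_lt h.B_lt_one

theorem a_le (h : IsMoranRatios A B a b) (n : ℕ) : a n ≤ B := by linarith [h.add_le n, h.b_pos n]

theorem b_le (h : IsMoranRatios A B a b) (n : ℕ) : b n ≤ B := by linarith [h.add_le n, h.a_pos n]

theorem B_pos (h : IsMoranRatios A B a b) : 0 < B := (h.a_pos 0).trans_le (h.a_le 0)

theorem length_pos (h : IsMoranRatios A B a b) (σ : ℕ → Bool) (n : ℕ) : 0 < moranLength a b σ n :=
  moranLength_pos h.a_pos h.b_pos σ n

theorem length_succ_le (h : IsMoranRatios A B a b) (σ : ℕ → Bool) (n : ℕ) :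
    moranLength a b σ (n + 1) ≤ B * moranLength a b σ n := by
  have hl := (h.length_pos σ n).le
  simp only [moranLength]
  split_ifs
  · exact mul_le_mul_of_nonneg_right (h.b_le n) hl
  · exact mul_le_mul_of_nonneg_right (h.a_le n) hl

theorem le_length_succ (h : IsMoranRatios A B a b) (σ : ℕ → Bool) (n : ℕ) :
    A * moranLength a b σ n ≤ moranLength a b σ (n + 1) := by
  have hl := (h.length_pos σ n).le
  simp only [moranLength]
  split_ifs
  · exact mul_le_mul_of_nonneg_right (h.le_b n) hl
  · exact mul_le_mul_of_nonneg_right (h.le_a n) hl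

theorem length_antitone (h : IsMoranRatios A B a b) (σ : ℕ → Bool) : Antitone (moranLength a b σ) :=
  antitone_nat_of_succ_le fun n => (h.length_succ_le σ n).trans
    (mul_le_of_le_one_left (h.length_pos σ n).le h.B_lt_one.le)

theorem length_le_pow (h : IsMoranRatios A B a b) (σ : ℕ → Bool) (n : ℕ) :
    moranLength a b σ n ≤ B ^ n := by
  induction n with
  | zero => simp [moranLength]
  | succ n ih =>
    rw [pow_succ']
    exact (h.length_succ_le σ n).trans (mul_le_mul_of_nonneg_left ih h.B_pos.le)

theorem pow_mul_length_le (h : IsMoranRatios A B a b) (σ : ℕ → Bool) (n k : ℕ) :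
    A ^ k * moranLength a b σ n ≤ moranLength a b σ (n + k) := by
  induction k with
  | zero => simp
  | succ k ih =>
    rw [pow_succ', mul_assoc]
    exact (mul_le_mul_of_nonneg_left ih h.A_pos.le).trans (h.le_length_succ σ (n + k))

theorem pow_le_length (h : IsMoranRatios A B a b) (σ : ℕ → Bool) (n : ℕ) :
    A ^ n ≤ moranLength a b σ n := by
  simpa [moranLength] using h.pow_mul_length_le σ 0 n

theorem tendsto_length (h : IsMoranRatios A B a b) (σ : ℕ → Bool) :
    Tendsto (moranLength a b σ) atTop (𝓝 0) :=
  squeeze_zero (fun n => (h.length_pos σ n).le) (h.length_le_pow σ)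
    (tendsto_pow_atTop_nhds_zero_of_lt_one h.B_pos.le h.B_lt_one)

theorem exists_length_lt (h : IsMoranRatios A B a b) (σ : ℕ → Bool) {ε : ℝ} (hε : 0 < ε) :
    ∃ n, moranLength a b σ n < ε :=
  ((h.tendsto_length σ).eventually_lt_const hε).exists

/-- Points of the Moran set whose addresses first differ at step `k` are separated by the gap. -/
theorem gap_le_dist (h : IsMoranRatios A B a b) {σ τ : ℕ → Bool} {k : ℕ} (heq :
    ∀ i < k, τ i = σ i) (hne : τ k ≠ σ k) :
    (1 - B) * moranLength a b σ k ≤ dist (moranPoint a b σ) (moranPoint a b τ) := by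
  obtain ⟨e1, e2⟩ := moranInterval_congr (a := a) (b := b) heq
  have hs := moranPoint_mem h.a_pos h.b_pos h.add_lt_one σ (k + 1)
  have ht := moranPoint_mem h.a_pos h.b_pos h.add_lt_one τ (k + 1)
  have hl := h.length_pos σ k
  have hab := h.add_le k
  rw [Real.dist_eq]
  simp only [moranInterval, moranLeft, moranLength, mem_Icc, e1, e2] at hs ht
  rcases hσ : σ k with _ | _ <;> rcases hτ : τ k with _ | _ <;>
    simp only [hσ, hτ, if_true, if_false, Bool.false_eq_true, ne_eq, not_true] at hs ht hne
  · rw [abs_sub_comm]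
    refine le_trans ?_ (le_abs_self _)
    nlinarith
  · refine le_trans ?_ (le_abs_self _)
    nlinarith

/-- If the addresses first differed at a step `k < n`, the gap there, at least `(1 - B)` times the
length at step `k`, would already be at least `R`, because lengths decrease. -/
theorem mem_moranInterval_of_dist_lt (h : IsMoranRatios A B a b) {σ τ : ℕ → Bool} {n : ℕ} {R : ℝ}
    (hR : R ≤ (1 - B) * moranLength a b σ n)
    (hd : dist (moranPoint a b τ) (moranPoint a b σ) < R) :
    moranPoint a b τ ∈ moranInterval a b σ n := by
  rw [moranPoint_mem_iff h.a_pos h.b_pos h.add_lt_one]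
  by_contra! hne
  classical
  have hk := Nat.find_spec hne
  set k := Nat.find hne
  have heq : ∀ i < k, τ i = σ i := by
    intro i hi
    have := Nat.find_min hne hi
    push Not at this
    exact this (hi.trans hk.1)
  have h1 := h.gap_le_dist heq hk.2
  have h2 := h.length_antitone σ hk.1.le
  have h3 : 0 < 1 - B := by linarith [h.B_lt_one]
  rw [dist_comm] at hd
  nlinarith

theorem measure_moranInterval (h : IsMoranRatios A B a b) (p : ℕ → unitInterval) (σ :
    ℕ → Bool) (n : ℕ) :
    moranMeasure a b p (moranInterval a b σ n) = ENNReal.ofReal (moranMass p σ n) := by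
  rw [moranMeasure_moranInterval h.a_pos h.b_pos h.add_lt_one, moranMass,
    ENNReal.ofReal_prod_of_nonneg]
  intro i _
  split_ifs
  · exact sub_nonneg.2 (p i).2.2
  · exact (p i).2.1

theorem measure_ball_le (h : IsMoranRatios A B a b) (p : ℕ → unitInterval)
    {σ : ℕ → Bool} {n : ℕ} {R : ℝ}
    (hR : R ≤ (1 - B) * moranLength a b σ n) :
    moranMeasure a b p (Metric.ball (moranPoint a b σ) R) ≤
      ENNReal.ofReal (moranMass p σ n) := by
  rw [← h.measure_moranInterval p σ n, moranMeasure,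
    Measure.map_apply measurable_moranPoint measurableSet_ball,
    Measure.map_apply measurable_moranPoint (by exact measurableSet_Icc)]
  exact measure_mono fun τ hτ => h.mem_moranInterval_of_dist_lt hR hτ

theorem le_measure_ball (h : IsMoranRatios A B a b) (p : ℕ → unitInterval)
    {σ : ℕ → Bool} {n : ℕ} {r : ℝ}
    (hr : moranLength a b σ n < r) :
    ENNReal.ofReal (moranMass p σ n) ≤
      moranMeasure a b p (Metric.ball (moranPoint a b σ) r) := by
  rw [← h.measure_moranInterval p σ n]
  refine measure_mono fun x hx => ?_
  have hy := moranPoint_mem h.a_pos h.b_pos h.add_lt_one σ n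
  rw [Metric.mem_ball, Real.dist_eq]
  simp only [moranInterval, mem_Icc] at hx hy
  rw [abs_lt]
  constructor <;> linarith

theorem moranPoint_mem_support (h : IsMoranRatios A B a b)
    (hp : ∀ n, (p n : ℝ) ∈ Ioo (0 : ℝ) 1) (σ : ℕ → Bool) :
    moranPoint a b σ ∈ (moranMeasure a b p).support := by
  rw [Measure.mem_support_iff_forall]
  intro U hU
  obtain ⟨ε, hε, hsub⟩ := Metric.mem_nhds_iff.1 hU
  obtain ⟨n, hn⟩ := h.exists_length_lt σ hε
  exact (ENNReal.ofReal_pos.2 (moranMass_pos hp σ n)).trans_le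
    ((h.le_measure_ball p hn).trans (measure_mono hsub))

theorem log_mass_succ (h : IsMoranRatios A B a b)
    (hp : ∀ n, (p n : ℝ) ∈ Ioo (0 : ℝ) 1) (θ : ℝ) (σ : ℕ → Bool) (n : ℕ) :
    Real.log (moranMass p σ (n + 1)) - θ * Real.log (moranLength a b σ (n + 1)) =
      Real.log (moranMass p σ n) - θ * Real.log (moranLength a b σ n) +
        if σ n then Real.log (1 - p n) - θ * Real.log (b n)
        else Real.log (p n) - θ * Real.log (a n) := by
  have h1 := moranMass_pos hp σ n
  have h2 := h.length_pos σ n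
  have h3 : 1 - (p n : ℝ) ≠ 0 := (sub_pos.2 (hp n).2).ne'
  rw [moranMass, Finset.prod_range_succ, ← moranMass]
  simp only [moranLength]
  split_ifs
  · rw [Real.log_mul h1.ne' h3, Real.log_mul (h.b_pos n).ne' h2.ne']
    ring
  · rw [Real.log_mul h1.ne' (hp n).1.ne', Real.log_mul (h.a_pos n).ne' h2.ne']
    ring

/-- The sum does not depend on `σ`; this is what makes the upper bound uniform over the support. -/
theorem sum_moranIncr_le (h : IsMoranRatios A B a b)
    (hp : ∀ n, (p n : ℝ) ∈ Ioo (0 : ℝ) 1) (θ : ℝ) (σ : ℕ → Bool) (n k : ℕ) :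
    Real.log (moranMass p σ n) - θ * Real.log (moranLength a b σ n) +
        ∑ i ∈ Finset.Ico n (n + k), moranIncr θ (a i) (b i) (p i) ≤
      Real.log (moranMass p σ (n + k)) - θ * Real.log (moranLength a b σ (n + k)) := by
  induction k with
  | zero => simp
  | succ k ih =>
    rw [← add_assoc n k 1, Finset.sum_Ico_succ_top (by omega), h.log_mass_succ hp]
    have : moranIncr θ (a (n + k)) (b (n + k)) (p (n + k)) ≤
        if σ (n + k) then Real.log (1 - p (n + k)) - θ * Real.log (b (n + k))
        else Real.log (p (n + k)) - θ * Real.log (a (n + k)) := by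
      unfold moranIncr
      split_ifs
      · exact min_le_right _ _
      · exact min_le_left _ _
    linarith

/-- The address that follows the smaller increment at each step. -/
theorem exists_address_eq_sum_moranIncr (h : IsMoranRatios A B a b)
    (hp : ∀ n, (p n : ℝ) ∈ Ioo (0 : ℝ) 1) (θ : ℝ) : ∃ σ : ℕ → Bool, ∀ n,
    Real.log (moranMass p σ n) - θ * Real.log (moranLength a b σ n) =
      ∑ i ∈ Finset.range n, moranIncr θ (a i) (b i) (p i) := by
  classical
  refine ⟨fun i => decide (Real.log (1 - p i) - θ * Real.log (b i) ≤
    Real.log (p i) - θ * Real.log (a i)), fun n => ?_⟩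
  induction n with
  | zero => simp [moranMass, moranLength]
  | succ n ih =>
    rw [h.log_mass_succ hp, ih, Finset.sum_range_succ]
    simp only [decide_eq_true_eq, add_right_inj, moranIncr]
    split_ifs with hle
    · rw [min_eq_right hle]
    · rw [min_eq_left (le_of_not_ge hle)]

end IsMoranRatios

/-! ### Bounds for the upper `Φ`-dimension of a fixed realisation. -/

namespace IsMoranRatios

variable {A B : ℝ} {a b : ℕ → ℝ} {p : ℕ → unitInterval}

/-- If the sums of the smaller increments tend to `-∞`, already one local dimension is at least
`θ`, and so is every upper `Φ`-dimension. -/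
theorem le_upperPhiDim (h : IsMoranRatios A B a b) (hp : ∀ n, (p n : ℝ) ∈ Ioo (0 : ℝ) 1)
    {Φ : ℝ → ℝ} (hΦ : IsDimensionFunction Φ) {θ : ℝ}
    (hsum : Tendsto (fun n => ∑ i ∈ Finset.range n, moranIncr θ (a i) (b i) (p i)) atTop atBot) :
    (θ : EReal) ≤ upperPhiDim Φ (moranMeasure a b p) := by
  refine le_sInf ?_
  rintro D ⟨d, rfl, C₁, hC₁, C₂, hC₂, hd⟩
  rw [EReal.coe_le_coe_iff]
  by_contra! hlt
  obtain ⟨δ, hδ, hΦ0, -⟩ := hΦ.exists_nonneg_monotone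
  obtain ⟨σ, hσ⟩ := h.exists_address_eq_sum_moranIncr hp θ
  set x := moranPoint a b σ
  -- The large radius stays fixed while `r` tends to `0`; the size of `Φ` then plays no role.
  obtain ⟨R, hR0, hR⟩ : ∃ R, 0 < R ∧ R < min δ C₁ := exists_between (lt_min hδ.1 hC₁)
  have hRδ : R < δ := hR.trans_le (min_le_left _ _)
  have hR1 : R < 1 := hRδ.trans_le hδ.2
  have hB : 0 < 1 - B := by linarith [h.B_lt_one]
  have hRR : R ^ (1 + Φ R) ≤ R := by
    simpa using Real.rpow_le_rpow_of_exponent_ge hR0 hR1.le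
      (by linarith [hΦ0 R ⟨hR0, hRδ⟩] : (1 : ℝ) ≤ 1 + Φ R)
  set μ := moranMeasure a b p
  have hx : x ∈ μ.support := h.moranPoint_mem_support hp σ
  have hM : 0 < μ.real (Metric.ball x R) := by
    refine ENNReal.toReal_pos (ne_of_gt ?_) (measure_ne_top _ _)
    exact (Measure.mem_support_iff_forall x).1 hx _ (Metric.ball_mem_nhds x hR0)
  have hlim : Tendsto (fun n => C₂ * (R / (1 - B)) ^ θ *
      Real.exp (∑ i ∈ Finset.range n, moranIncr θ (a i) (b i) (p i))) atTop (𝓝 0) := by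
    simpa using (Real.tendsto_exp_atBot.comp hsum).const_mul (C₂ * (R / (1 - B)) ^ θ)
  have hev := hlim.eventually_lt_const hM
  have hr : ∀ᶠ n in atTop, (1 - B) * moranLength a b σ n < R ^ (1 + Φ R) := by
    have : Tendsto (fun n => (1 - B) * moranLength a b σ n) atTop (𝓝 0) := by
      simpa using (h.tendsto_length σ).const_mul (1 - B)
    exact this.eventually_lt_const (Real.rpow_pos_of_pos hR0 _)
  obtain ⟨n, hn1, hn2⟩ := (hev.and hr).exists
  have hL := h.length_pos σ n
  -- With this radius the ball around `x` carries no more mass than the step `n` interval.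
  set r := (1 - B) * moranLength a b σ n
  have hr0 : 0 < r := mul_pos hB hL
  have key := hd r R hr0 hn2 hRR (hR.trans_le (min_le_right _ _)).le hR1 x hx
  have hQ := moranMass_pos hp σ n
  have hball : μ (Metric.ball x r) ≤ ENNReal.ofReal (moranMass p σ n) :=
    h.measure_ball_le p le_rfl
  have hmul : μ (Metric.ball x R) ≤
      ENNReal.ofReal (C₂ * (R / r) ^ d) * ENNReal.ofReal (moranMass p σ n) := by
    rw [ENNReal.div_le_iff (((Measure.mem_support_iff_forall x).1 hx _
      (Metric.ball_mem_nhds x hr0)).ne') (measure_ne_top _ _)] at key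
    exact key.trans (by gcongr)
  have hRr : 1 ≤ R / r := by rw [one_le_div hr0]; linarith
  have hC : 0 ≤ C₂ * (R / r) ^ d := by positivity
  rw [← ENNReal.ofReal_mul hC] at hmul
  have hreal : μ.real (Metric.ball x R) ≤ C₂ * (R / r) ^ d * moranMass p σ n :=
    ENNReal.toReal_le_of_le_ofReal (mul_nonneg hC hQ.le) hmul
  have hpow : (R / r) ^ d ≤ (R / r) ^ θ := Real.rpow_le_rpow_of_exponent_le hRr hlt.le
  have hexp : (R / r) ^ θ * moranMass p σ n = (R / (1 - B)) ^ θ *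
      Real.exp (∑ i ∈ Finset.range n, moranIncr θ (a i) (b i) (p i)) := by
    rw [← hσ n, Real.exp_sub, Real.exp_log hQ, mul_comm θ, Real.exp_mul, Real.exp_log hL,
      ← div_div, Real.div_rpow (by positivity) hL.le]
    ring
  have : C₂ * (R / r) ^ d * moranMass p σ n ≤ C₂ * (R / r) ^ θ * moranMass p σ n := by gcongr
  rw [mul_assoc C₂ ((R / r) ^ θ), hexp, ← mul_assoc] at this
  linarith

/-- Comparison of two balls around a point of the Moran set, in terms of Moran intervals. -/
theorem measure_ball_div_le (h : IsMoranRatios A B a b) (hp : ∀ n, (p n : ℝ) ∈ Ioo (0 : ℝ) 1)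
    {θ : ℝ} (hθ : 0 ≤ θ) {σ : ℕ → Bool} {r R : ℝ} (hr : 0 < r) (hrR : r < R)
    (hR : R ≤ 1 - B)
    (hsum : ∀ n k : ℕ, R ≤ B ^ n → (1 - B) * A * A ^ n < R → A ^ k ≤ r / R →
      0 ≤ ∑ i ∈ Finset.Ico n (n + k), moranIncr θ (a i) (b i) (p i)) :
    moranMeasure a b p (Metric.ball (moranPoint a b σ) R) /
        moranMeasure a b p (Metric.ball (moranPoint a b σ) r) ≤
      ENNReal.ofReal ((1 / ((1 - B) * A * A)) ^ θ * (R / r) ^ θ) := by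
  have hB : 0 < 1 - B := by linarith [h.B_lt_one]
  have hA := h.A_pos
  have hR0 : 0 < R := hr.trans hrR
  -- The last step whose interval is sure to carry the mass of the `R`-ball; `R ≤ 1 - B` ensures
  -- that step `0` qualifies.
  obtain ⟨n, hn1, hn2⟩ : ∃ n, R ≤ (1 - B) * moranLength a b σ n ∧
      (1 - B) * moranLength a b σ (n + 1) < R := by
    classical
    have hex : ∃ N, (1 - B) * moranLength a b σ N < R := by
      obtain ⟨N, hN⟩ := h.exists_length_lt σ (div_pos hR0 hB)
      exact ⟨N, by rwa [lt_div_iff₀' hB] at hN⟩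
    have h0 : Nat.find hex ≠ 0 := by
      intro h0
      have := Nat.find_spec hex
      rw [h0] at this
      simp only [moranLength, mul_one] at this
      linarith
    obtain ⟨n, hn⟩ := Nat.exists_eq_succ_of_ne_zero h0
    refine ⟨n, not_lt.1 (Nat.find_min hex (by omega)), ?_⟩
    have := Nat.find_spec hex
    rwa [hn] at this
  -- The first step whose interval fits into the `r`-ball; one step shrinks lengths at most by the
  -- factor `A`.
  obtain ⟨m, hm1, hm2⟩ : ∃ m, A * r ≤ moranLength a b σ m ∧ moranLength a b σ m < r := by
    classical
    have hex := h.exists_length_lt σ hr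
    have h0 : Nat.find hex ≠ 0 := by
      intro h0
      have := Nat.find_spec hex
      rw [h0] at this
      simp only [moranLength] at this
      linarith [h.B_pos]
    obtain ⟨m, hm⟩ := Nat.exists_eq_succ_of_ne_zero h0
    refine ⟨m + 1, ?_, ?_⟩
    · have := not_lt.1 (Nat.find_min hex (m := m) (by omega))
      exact (mul_le_mul_of_nonneg_left this hA.le).trans (h.le_length_succ σ m)
    · have := Nat.find_spec hex
      rwa [hm] at this
  have hLn := h.length_pos σ n
  have hLm := h.length_pos σ m
  have hnm : n ≤ m := by
    by_contra! hlt
    have := h.length_antitone σ hlt.le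
    nlinarith [h.B_pos]
  obtain ⟨k, rfl⟩ := Nat.exists_eq_add_of_le hnm
  have hs := h.le_length_succ σ n
  have hAn : (1 - B) * A * moranLength a b σ n < R := by nlinarith
  -- The conditions in `hsum` do not mention `σ`: `A ^ n` and `B ^ n` enclose the length at step
  -- `n`, and `A ^ k` is at most the ratio of the two lengths, which is below `r / R`.
  have hsum' := hsum n k
    (hn1.trans ((mul_le_of_le_one_left hLn.le (by linarith [h.B_pos])).trans
      (h.length_le_pow σ n)))
    ((mul_le_mul_of_nonneg_left (h.pow_le_length σ n) (by positivity)).trans_lt hAn)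
    (by
      have := h.pow_mul_length_le σ n k
      rw [le_div_iff₀ hR0]
      have hk : 0 < A ^ k := by positivity
      have hRL : R ≤ moranLength a b σ n :=
        hn1.trans (mul_le_of_le_one_left hLn.le (by linarith [h.B_pos]))
      nlinarith)
  have hinc := h.sum_moranIncr_le hp θ σ n k
  have hQn := moranMass_pos hp σ n
  have hQm := moranMass_pos hp σ (n + k)
  have hle : moranMass p σ n / moranMass p σ (n + k) ≤
      (moranLength a b σ n / moranLength a b σ (n + k)) ^ θ := by
    rw [← Real.log_le_log_iff (by positivity) (by positivity),
      Real.log_div hQn.ne' hQm.ne', Real.log_rpow (by positivity),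
      Real.log_div hLn.ne' hLm.ne']
    linarith
  -- The choice of `n` loses the factor `(1 - B) * A`, the choice of `m` another `A`.
  have hle2 : moranLength a b σ n / moranLength a b σ (n + k) ≤
      1 / ((1 - B) * A * A) * (R / r) := by
    rw [div_mul_div_comm, one_mul, div_le_div_iff₀ hLm (by positivity)]
    calc moranLength a b σ n * ((1 - B) * A * A * r)
        = ((1 - B) * A * moranLength a b σ n) * (A * r) := by ring
      _ ≤ R * moranLength a b σ (n + k) := by gcongr
  calc _ ≤ ENNReal.ofReal (moranMass p σ n) / ENNReal.ofReal (moranMass p σ (n + k)) :=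
        ENNReal.div_le_div (h.measure_ball_le p hn1) (h.le_measure_ball p hm2)
    _ = ENNReal.ofReal (moranMass p σ n / moranMass p σ (n + k)) :=
        (ENNReal.ofReal_div_of_pos hQm).symm
    _ ≤ _ := by
      refine ENNReal.ofReal_le_ofReal (hle.trans ?_)
      rw [← Real.mul_rpow (by positivity) (by positivity)]
      exact Real.rpow_le_rpow (by positivity) hle2 hθ

/-- If the sums of the smaller increments over long enough blocks are eventually non-negative,
then `θ` bounds the upper `Φ`-dimension for every large dimension function `Φ`. -/
theorem upperPhiDim_le (h : IsMoranRatios A B a b) (hp : ∀ n, (p n : ℝ) ∈ Ioo (0 : ℝ) 1)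
    {Φ : ℝ → ℝ} (hΦ : IsLargeDimensionFunction Φ) {θ K : ℝ} (hθ : 0 ≤ θ) (hK : 0 < K) {N : ℕ}
    (hsum : ∀ n ≥ N, ∀ k : ℕ, K * Real.log n ≤ k →
      0 ≤ ∑ i ∈ Finset.Ico n (n + k), moranIncr θ (a i) (b i) (p i)) :
    upperPhiDim Φ (moranMeasure a b p) ≤ θ := by
  have hA := h.A_pos
  have hB := h.B_pos
  have hB1 : 0 < 1 - B := by linarith [h.B_lt_one]
  have hA1 : A < 1 := (h.le_a 0).trans_lt ((h.a_le 0).trans_lt h.B_lt_one)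
  have hlogA : 0 < -Real.log A := neg_pos.2 (Real.log_neg hA hA1)
  have hlogB : 0 < -Real.log B := neg_pos.2 (Real.log_neg hB h.B_lt_one)
  obtain ⟨H, hH, hΦH⟩ := hΦ.exists_factor
  obtain ⟨δ, hδ, hΦ0, -⟩ := hΦ.exists_nonneg_monotone
  have hlog : Tendsto (fun R => -Real.log R) (𝓝[>] 0) atTop :=
    tendsto_neg_atBot_atTop.comp Real.tendsto_log_nhdsGT_zero
  have hloglog : Tendsto (fun R => Real.log (-Real.log R)) (𝓝[>] 0) atTop :=
    Real.tendsto_log_atTop.comp hlog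
  have hid : Tendsto (fun R : ℝ => R) (𝓝[>] 0) (𝓝 0) := tendsto_id.mono_left nhdsWithin_le_nhds
  -- The bound on `H R` yields `K log n ≤ k`, the bound on `log (-log R)` absorbs the constant in `n
  -- ≤ -log R / -log B`, and the bound by `A ^ N` forces `n ≥ N`.
  have hev : ∀ᶠ R in 𝓝[>] (0 : ℝ), Φ R = H R * (Real.log |Real.log R| / |Real.log R|) ∧
      2 * K * (-Real.log A) ≤ H R ∧ 1 < -Real.log R ∧
      -Real.log (-Real.log B) ≤ Real.log (-Real.log R) ∧
      2 * R < (1 - B) * A * A ^ N ∧ R < δ ∧ 2 * R ≤ 1 - B := by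
    have h2 : Tendsto (fun R : ℝ => 2 * R) (𝓝[>] 0) (𝓝 0) := by simpa using hid.const_mul 2
    filter_upwards [hΦH, hH.eventually_ge_atTop (2 * K * (-Real.log A)),
      hlog.eventually_gt_atTop 1, hloglog.eventually_ge_atTop (-Real.log (-Real.log B)),
      h2.eventually_lt_const (by positivity : 0 < (1 - B) * A * A ^ N),
      hid.eventually_lt_const hδ.1, h2.eventually_le_const hB1] with R h1 h2 h3 h4 h5 h6 h7
    exact ⟨h1, h2, h3, h4, h5, h6, h7⟩
  obtain ⟨C, hC, hCsub⟩ := mem_nhdsGT_iff_exists_Ioo_subset.1 hev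
  rw [mem_Ioi] at hC
  -- The factor `4 ^ θ` pays for recentring the balls at a Moran point within `r / 2` of `x`: `R` is
  -- doubled and `r` is halved.
  refine sInf_le ⟨θ, rfl, C / 2, half_pos hC, (1 / ((1 - B) * A * A)) ^ θ * 4 ^ θ,
    by positivity, ?_⟩
  intro r R hr hrR hRR hRC hR1 x hx
  have hR0 : 0 < R := hr.trans (hrR.trans_le hRR)
  obtain ⟨e1, e2, e3, e4, e5, e6, e7⟩ := hCsub ⟨hR0, by linarith⟩
  obtain ⟨σ, hσ⟩ := exists_moranPoint_near hx (half_pos hr)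
  have hrR' : r < R := hrR.trans_le hRR
  have main := h.measure_ball_div_le hp hθ (σ := σ) (r := r / 2) (R := 2 * R) (by linarith)
    (by linarith) e7 (by
      intro n k hn1 hn2 hk
      apply hsum
      · by_contra! hlt
        have := pow_le_pow_of_le_one hA.le hA1.le hlt.le
        have : (1 - B) * A * A ^ N ≤ (1 - B) * A * A ^ n := by gcongr
        linarith
      set L := -Real.log R with hLdef
      have hlogn : Real.log n ≤ 2 * Real.log L := by
        -- For `n = 0` the convention `Real.log 0 = 0` applies.
        rcases Nat.eq_zero_or_pos n with rfl | hn
        · simpa using Real.log_nonneg e3.le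
        have hle : n * (-Real.log B) ≤ L := by
          have := Real.log_le_log hR0 (by linarith : R ≤ B ^ n)
          rw [Real.log_pow] at this
          linarith
        have hn' : (0 : ℝ) < n := by exact_mod_cast hn
        have := Real.log_le_log (by positivity) hle
        rw [Real.log_mul hn'.ne' hlogB.ne'] at this
        linarith
      have hL0 : 0 < L := by linarith
      have hk' : r / 2 / (2 * R) ≤ R ^ Φ R := by
        rw [Real.rpow_add hR0, Real.rpow_one] at hrR
        rw [div_div, div_le_iff₀ (by positivity)]
        nlinarith
      have hk2 := Real.log_le_log (by positivity) (hk.trans hk')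
      rw [Real.log_pow, Real.log_rpow hR0] at hk2
      have habs : |Real.log R| = L := by rw [abs_of_neg (by linarith), hLdef]
      -- Hence `R ^ Φ R = L ^ (-H R)`, and `A ^ k ≤ R ^ Φ R` makes `k` at least `H R * log L / -log
      -- A`.
      have hΦL : Φ R * Real.log R = -(H R * Real.log L) := by
        rw [e1, habs, (by rw [hLdef, neg_neg] : Real.log R = -L)]
        field_simp
      have hlogL : 0 < Real.log L := Real.log_pos e3
      have : K * Real.log n * (-Real.log A) ≤ k * (-Real.log A) :=
        calc K * Real.log n * (-Real.log A) ≤ K * (2 * Real.log L) * (-Real.log A) := by gcongr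
          _ = 2 * K * (-Real.log A) * Real.log L := by ring
          _ ≤ H R * Real.log L := by gcongr
          _ ≤ k * (-Real.log A) := by linarith
      exact le_of_mul_le_mul_right this hlogA)
  have hsub1 : Metric.ball x R ⊆ Metric.ball (moranPoint a b σ) (2 * R) :=
    Metric.ball_subset_ball' (by rw [dist_comm]; linarith)
  have hsub2 : Metric.ball (moranPoint a b σ) (r / 2) ⊆ Metric.ball x r :=
    Metric.ball_subset_ball' (by linarith)
  refine (ENNReal.div_le_div (measure_mono hsub1) (measure_mono hsub2)).trans (main.trans ?_)
  refine le_of_eq ?_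
  rw [(by field_simp; norm_num : 2 * R / (r / 2) = 4 * (R / r)),
    Real.mul_rpow (by norm_num) (by positivity), ← mul_assoc]

end IsMoranRatios

/-! ### Independence of pairs, exponential tails and the law of large numbers. -/

namespace ProbabilityTheory

variable {Ω : Type*} [MeasurableSpace Ω] {P : Measure Ω}

/-- Rectangles form a generating π-system. For finitely many of them, independence of the two
sequences separates the `X` part from the `Y` part, and each part factorises by itself. -/
theorem iIndepFun.prodMk_of_indepFun {ι E F : Type*} [Countable ι] [MeasurableSpace E]
    [MeasurableSpace F]
    {X : ι → Ω → E} {Y : ι → Ω → F} (hX : ∀ i, Measurable (X i)) (hY : ∀ i, Measurable (Y i))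
    (iX : iIndepFun X P) (iY : iIndepFun Y P)
    (hXY : IndepFun (fun ω i => X i ω) (fun ω i => Y i ω) P) :
    iIndepFun (fun i ω => (X i ω, Y i ω)) P := by
  have inter : ∀ (s : Finset ι) (U : ι → Set E) (V : ι → Set F),
      (∀ i ∈ s, MeasurableSet (U i)) → (∀ i ∈ s, MeasurableSet (V i)) →
      P (⋂ i ∈ s, X i ⁻¹' U i ∩ Y i ⁻¹' V i) =
        (∏ i ∈ s, P (X i ⁻¹' U i)) * ∏ i ∈ s, P (Y i ⁻¹' V i) := by
    intro s U V hU hV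
    rw [← iX.measure_inter_preimage_eq_mul s hU, ← iY.measure_inter_preimage_eq_mul s hV]
    have h := hXY.measure_inter_preimage_eq_mul ((s : Set ι).pi U) ((s : Set ι).pi V)
      (MeasurableSet.pi s.countable_toSet hU) (MeasurableSet.pi s.countable_toSet hV)
    have e1 : (fun ω i => X i ω) ⁻¹' (s : Set ι).pi U = ⋂ i ∈ s, X i ⁻¹' U i := by
      ext ω; simp [Set.mem_pi]
    have e2 : (fun ω i => Y i ω) ⁻¹' (s : Set ι).pi V = ⋂ i ∈ s, Y i ⁻¹' V i := by
      ext ω; simp [Set.mem_pi]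
    rw [e1, e2] at h
    rw [← h]
    congr 1
    ext ω
    simp only [mem_iInter, mem_inter_iff]
    exact ⟨fun h => ⟨fun i hi => (h i hi).1, fun i hi => (h i hi).2⟩,
      fun h i hi => ⟨h.1 i hi, h.2 i hi⟩⟩
  rw [iIndepFun_iff_iIndep]
  refine iIndepSets.iIndep (fun i => ((hX i).prodMk (hY i)).comap_le)
    (fun i => preimage (fun ω => (X i ω, Y i ω)) ''
      image2 (· ×ˢ ·) {s | MeasurableSet s} {t | MeasurableSet t})
    (fun i => isPiSystem_prod.comap _) (fun i => ?_) ?_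
  · rw [← MeasurableSpace.comap_generateFrom, generateFrom_prod]
  · rw [iIndepSets_iff]
    intro s f hf
    have hf' : ∀ i, ∃ U V, i ∈ s → MeasurableSet U ∧ MeasurableSet V ∧
        f i = X i ⁻¹' U ∩ Y i ⁻¹' V := by
      intro i
      by_cases hi : i ∈ s
      · obtain ⟨_, ⟨U, hU, V, hV, rfl⟩, e⟩ := hf i hi
        exact ⟨U, V, fun _ => ⟨hU, hV, e.symm⟩⟩
      · exact ⟨∅, ∅, fun h => absurd h hi⟩
    choose U V hUV using hf'
    have hf2 : ∀ i ∈ s, f i = X i ⁻¹' U i ∩ Y i ⁻¹' V i := fun i hi => (hUV i hi).2.2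
    rw [iInter₂_congr hf2, inter s U V (fun i hi => (hUV i hi).1) (fun i hi => (hUV i hi).2.1),
      ← Finset.prod_mul_distrib]
    refine Finset.prod_congr rfl fun i hi => ?_
    rw [hf2 i hi]
    exact ((hXY.comp (measurable_pi_apply i)
      (measurable_pi_apply i)).measure_inter_preimage_eq_mul _ _ (hUV i hi).1 (hUV i hi).2.1).symm

theorem IdentDistrib.prodMk_of_indepFun {E F : Type*} [MeasurableSpace E] [MeasurableSpace F]
    [IsFiniteMeasure P] {X X' : Ω → E} {Y Y' : Ω → F} (hX : IdentDistrib X X' P P)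
    (hY : IdentDistrib Y Y' P P) (h : IndepFun X Y P) (h' : IndepFun X' Y' P) :
    IdentDistrib (fun ω => (X ω, Y ω)) (fun ω => (X' ω, Y' ω)) P P where
  aemeasurable_fst := hX.aemeasurable_fst.prodMk hY.aemeasurable_fst
  aemeasurable_snd := hX.aemeasurable_snd.prodMk hY.aemeasurable_snd
  map_eq := by
    rw [h.map_prod_eq_prod_map_map hX.aemeasurable_fst hY.aemeasurable_fst,
      h'.map_prod_eq_prod_map_map hX.aemeasurable_snd hY.aemeasurable_snd, hX.map_eq, hY.map_eq]

/-- The moment generating function equals `1` at `0` and has the mean as its derivative there, so it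
lies below `1` just to the left of `0`. -/
theorem exists_mgf_lt_one [IsProbabilityMeasure P] {X : Ω → ℝ}
    (hexp : 0 ∈ interior (integrableExpSet X P)) (hmean : 0 < ∫ ω, X ω ∂P) :
    ∃ s < 0, s ∈ integrableExpSet X P ∧ mgf X P s < 1 := by
  have hderiv : HasDerivAt (mgf X P) (∫ ω, X ω ∂P) 0 := by simpa using hasDerivAt_mgf hexp
  rw [hasDerivAt_iff_tendsto_slope] at hderiv
  have h1 : ∀ᶠ s in 𝓝[<] (0 : ℝ), 0 < slope (mgf X P) 0 s :=
    (hderiv.mono_left (nhdsWithin_mono _ fun s hs => ne_of_lt hs)).eventually_const_lt hmean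
  have h2 : ∀ᶠ s in 𝓝[<] (0 : ℝ), s ∈ integrableExpSet X P :=
    nhdsWithin_le_nhds (mem_interior_iff_mem_nhds.1 hexp)
  obtain ⟨s, ⟨hs1, hs2⟩, hs0⟩ := ((h1.and h2).and self_mem_nhdsWithin).exists
  refine ⟨s, hs0, hs2, ?_⟩
  rw [slope_def_field, mgf_zero, sub_zero] at hs1
  have hs0' : s < 0 := hs0
  rcases div_pos_iff.1 hs1 with h | h
  · linarith [h.2]
  · linarith [h.1]

/-- For i.i.d. variables with positive mean and exponential moments, almost surely the sums over
all far out blocks of at least logarithmic length are non-negative. -/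
theorem ae_exists_forall_sum_Ico_nonneg [IsProbabilityMeasure P] {X : ℕ → Ω → ℝ}
    (hX : ∀ i, Measurable (X i)) (hindep : iIndepFun X P)
    (hident : ∀ i, IdentDistrib (X i) (X 0) P P)
    (hexp : 0 ∈ interior (integrableExpSet (X 0) P)) (hmean : 0 < ∫ ω, X 0 ω ∂P) :
    ∃ K > 0, ∀ᵐ ω ∂P, ∃ N : ℕ, ∀ n ≥ N, ∀ k : ℕ, K * Real.log n ≤ k →
      0 ≤ ∑ i ∈ Finset.Ico n (n + k), X i ω := by
  obtain ⟨s, hs0, hs, hlt⟩ := exists_mgf_lt_one hexp hmean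
  have hpos : 0 < mgf (X 0) P s := mgf_pos hs
  set ρ := mgf (X 0) P s
  have hlog : 0 < -Real.log ρ := neg_pos.2 (Real.log_neg hpos hlt)
  -- Chernoff's bound with the negative parameter `s`.
  have tail : ∀ n k : ℕ, P.real {ω | ∑ i ∈ Finset.Ico n (n + k), X i ω < 0} ≤ ρ ^ k := by
    intro n k
    have hint : ∀ i, Integrable (fun ω => Real.exp (s * X i ω)) P := fun i =>
      ((hident i).comp (u := fun x => Real.exp (s * x)) (by fun_prop)).integrable_iff.2 hs
    have h1 := measure_le_le_exp_mul_mgf (μ := P) (X := ∑ i ∈ Finset.Ico n (n + k), X i) 0 hs0.le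
      (hindep.integrable_exp_mul_sum hX fun i _ => hint i)
    rw [hindep.mgf_sum hX, Finset.prod_eq_pow_card fun i _ =>
      mgf_congr_of_identDistrib (X i) (X 0) (hident i) s] at h1
    simp only [mul_zero, Real.exp_zero, one_mul, Nat.card_Ico, Finset.sum_apply,
      Nat.add_sub_cancel_left] at h1
    have hsub : {ω | ∑ i ∈ Finset.Ico n (n + k), X i ω < 0} ⊆
        {ω | ∑ i ∈ Finset.Ico n (n + k), X i ω ≤ 0} := by
      intro ω hω
      rw [mem_ofPred_eq] at hω ⊢
      exact hω.le
    exact (measureReal_mono hsub).trans h1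
  -- With the constant `4`, half of the exponent of `ρ ^ k` gives `√ρ ^ k ≤ n⁻²`; the other half is
  -- summable in `k`. Below, `n` is written `q.1 + 1` to keep it positive.
  refine ⟨4 / (-Real.log ρ), by positivity, ?_⟩
  let S : ℕ × ℕ → Set Ω := fun q => {ω | 4 / (-Real.log ρ) * Real.log ((q.1 + 1 : ℕ) : ℝ) ≤ q.2 ∧
    ∑ i ∈ Finset.Ico (q.1 + 1) (q.1 + 1 + q.2), X i ω < 0}
  let F : ℕ × ℕ → ℝ := fun q => (((q.1 + 1 : ℕ) : ℝ) ^ 2)⁻¹ * Real.sqrt ρ ^ q.2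
  have hF : Summable F := by
    refine Summable.mul_of_nonneg (f := fun n : ℕ => (((n + 1 : ℕ) : ℝ) ^ 2)⁻¹)
      (g := fun k : ℕ => Real.sqrt ρ ^ k) ?_ ?_ (fun _ => by positivity) (fun _ => by positivity)
    · exact (summable_nat_add_iff (f := fun n : ℕ => ((n : ℝ) ^ 2)⁻¹) 1).2
        (Real.summable_nat_pow_inv.2 one_lt_two)
    · exact summable_geometric_of_lt_one (Real.sqrt_nonneg _)
        ((Real.sqrt_lt' one_pos).2 (by simpa using hlt))
  have hS : ∀ q, P (S q) ≤ ENNReal.ofReal (F q) := by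
    rintro ⟨n, k⟩
    by_cases hk : 4 / (-Real.log ρ) * Real.log ((n + 1 : ℕ) : ℝ) ≤ k
    · have h1 : P (S (n, k)) ≤ ENNReal.ofReal (ρ ^ k) := by
        have hsub : S (n, k) ⊆ {ω | ∑ i ∈ Finset.Ico (n + 1) (n + 1 + k), X i ω < 0} := by
          intro ω hω
          exact hω.2
        refine (measure_mono hsub).trans ?_
        rw [← ofReal_measureReal]
        exact ENNReal.ofReal_le_ofReal (tail (n + 1) k)
      refine h1.trans (ENNReal.ofReal_le_ofReal ?_)
      have h2 : ρ ^ k = Real.sqrt ρ ^ k * Real.sqrt ρ ^ k := by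
        rw [← mul_pow, Real.mul_self_sqrt hpos.le]
      rw [h2]
      refine mul_le_mul_of_nonneg_right ?_ (by positivity)
      rw [← Real.log_le_log_iff (by positivity) (by positivity), Real.log_pow, Real.log_inv,
        Real.log_pow, Real.log_sqrt hpos.le]
      rw [div_mul_eq_mul_div, div_le_iff₀ hlog] at hk
      push_cast at hk ⊢
      linarith
    · have : S (n, k) = ∅ := by
        ext ω
        simp only [S, mem_ofPred_eq, mem_empty_iff_false, iff_false]
        exact fun h => hk h.1
      simp [this]
  have hsum : ∑' q, P (S q) ≠ ∞ := ne_top_of_le_ne_top hF.tsum_ofReal_ne_top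
    (ENNReal.tsum_le_tsum hS)
  filter_upwards [ae_finite_setOfPred_mem hsum] with ω hω
  obtain ⟨M, hM⟩ := (hω.image Prod.fst).bddAbove
  -- The first coordinates in `S` are shifted by one, so `n ≥ M + 2` puts `n - 1` above `M`.
  refine ⟨M + 2, fun n hn k hk => ?_⟩
  by_contra! hlt
  obtain ⟨n, rfl⟩ := Nat.exists_eq_add_of_le' (show 1 ≤ n by omega)
  have : n ≤ M := hM ⟨(n, k), ⟨hk, hlt⟩, rfl⟩
  omega

/-- By the law of large numbers, the partial sums of i.i.d. variables with negative mean tend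
to `-∞`. -/
theorem ae_tendsto_sum_atBot {X : ℕ → Ω → ℝ} (hint : Integrable (X 0) P)
    (hindep : iIndepFun X P) (hident : ∀ i, IdentDistrib (X i) (X 0) P P)
    (hmean : ∫ ω, X 0 ω ∂P < 0) :
    ∀ᵐ ω ∂P, Tendsto (fun n => ∑ i ∈ Finset.range n, X i ω) atTop atBot := by
  filter_upwards [strong_law_ae_real X hint (fun i j hij => hindep.indepFun hij) hident]
    with ω hω
  have h := hω.neg_mul_atTop hmean tendsto_natCast_atTop_atTop
  refine h.congr' ?_
  filter_upwards [eventually_gt_atTop 0] with n hn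
  have : (n : ℝ) ≠ 0 := by positivity
  field_simp

end ProbabilityTheory

/-! ### Pointwise estimates for the increment. -/

section Increment

variable {A B x y q θ θ' : ℝ}

theorem measurable_moranIncr (θ : ℝ) :
    Measurable fun u : (ℝ × ℝ) × unitInterval => moranIncr θ u.1.1 u.1.2 u.2 := by
  unfold moranIncr
  fun_prop

/-- On `(0, 1)` the increment is the combination of `Y(θ)` and `Z(θ)` in the definition of `G`. -/
theorem moranY_sub_moranZ (hx : 0 < x) (hy : 0 < y) (hq : q ∈ Ioo (0 : ℝ) 1) :
    moranY θ x y q - θ * moranZ θ x y q = moranIncr θ x y q := by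
  have hX : 0 < x ^ θ := Real.rpow_pos_of_pos hx θ
  have hY : 0 < y ^ θ := Real.rpow_pos_of_pos hy θ
  have hq1 : 0 < 1 - q := sub_pos.2 hq.2
  -- Clearing the denominator leaves `q * y ^ θ ≤ (1 - q) * x ^ θ`, whose logarithm is the
  -- comparison of the two increments.
  have key : q ≤ x ^ θ / (x ^ θ + y ^ θ) ↔
      Real.log q - θ * Real.log x ≤ Real.log (1 - q) - θ * Real.log y := by
    rw [le_div_iff₀ (by positivity)]
    have h1 : q * (x ^ θ + y ^ θ) ≤ x ^ θ ↔ q * y ^ θ ≤ (1 - q) * x ^ θ := by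
      constructor <;> intro h <;> nlinarith
    rw [h1, ← Real.log_le_log_iff (mul_pos hq.1 hY) (mul_pos hq1 hX),
      Real.log_mul hq.1.ne' hY.ne', Real.log_mul hq1.ne' hX.ne', Real.log_rpow hx,
      Real.log_rpow hy]
    constructor <;> intro h <;> linarith
  simp only [moranY, moranZ, moranIncr, key]
  split_ifs with h
  · rw [min_eq_left h]
  · rw [min_eq_right (le_of_not_ge h)]

theorem moranIncr_add_le (hx : 0 < x) (hy : 0 < y) (hxB : x ≤ B) (hyB : y ≤ B) (hθ : θ ≤ θ') :
    moranIncr θ x y q + (θ' - θ) * (-Real.log B) ≤ moranIncr θ' x y q := by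
  have h1 := Real.log_le_log hx hxB
  have h2 := Real.log_le_log hy hyB
  have h3 : 0 ≤ θ' - θ := sub_nonneg.2 hθ
  refine le_min ?_ ?_
  · have := min_le_left (Real.log q - θ * Real.log x) (Real.log (1 - q) - θ * Real.log y)
    unfold moranIncr
    nlinarith
  · have := min_le_right (Real.log q - θ * Real.log x) (Real.log (1 - q) - θ * Real.log y)
    unfold moranIncr
    nlinarith

theorem moranIncr_le_add (hA : 0 < A) (hxA : A ≤ x) (hyA : A ≤ y) (hθ : θ ≤ θ') :
    moranIncr θ' x y q ≤ moranIncr θ x y q + (θ' - θ) * (-Real.log A) := by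
  have h1 := Real.log_le_log hA hxA
  have h2 := Real.log_le_log hA hyA
  have h3 : 0 ≤ θ' - θ := sub_nonneg.2 hθ
  rw [← sub_le_iff_le_add]
  refine le_min ?_ ?_
  · have := min_le_left (Real.log q - θ' * Real.log x) (Real.log (1 - q) - θ' * Real.log y)
    unfold moranIncr
    nlinarith
  · have := min_le_right (Real.log q - θ' * Real.log x) (Real.log (1 - q) - θ' * Real.log y)
    unfold moranIncr
    nlinarith

/-- As `-θ log x` and `-θ log y` are non-negative, dropping them only enlarges the exponential. What
remains is `q ^ (-s)` or `(1 - q) ^ (-s)`, with base below `1`. -/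
theorem exp_neg_mul_moranIncr_le {s t₁ t₂ : ℝ} (hθ : 0 ≤ θ) (hx : x ∈ Ioo (0 : ℝ) 1)
    (hy : y ∈ Ioo (0 : ℝ) 1) (hq : q ∈ Ioo (0 : ℝ) 1) (hs : 0 ≤ s) (h₁ : s ≤ t₁) (h₂ : s ≤ t₂) :
    Real.exp (-s * moranIncr θ x y q) ≤ q ^ (-t₁) + (1 - q) ^ (-t₂) := by
  have hq1 : 0 < 1 - q := sub_pos.2 hq.2
  have aux : ∀ {u v t : ℝ}, 0 < u → u < 1 → v ∈ Ioo (0 : ℝ) 1 → s ≤ t →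
      Real.exp (-s * (Real.log u - θ * Real.log v)) ≤ u ^ (-t) := by
    intro u v t hu hu1 hv ht
    rw [Real.rpow_def_of_pos hu, Real.exp_le_exp]
    have h1 := Real.log_neg hu hu1
    have h2 : 0 ≤ s * (θ * -Real.log v) :=
      mul_nonneg hs (mul_nonneg hθ (neg_nonneg.2 (Real.log_neg hv.1 hv.2).le))
    nlinarith
  unfold moranIncr
  rcases min_choice (Real.log q - θ * Real.log x) (Real.log (1 - q) - θ * Real.log y) with h | h
  · rw [h]
    linarith [aux hq.1 hq.2 hx h₁, Real.rpow_pos_of_pos hq1 (-t₂)]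
  · rw [h]
    linarith [aux hq1 (by linarith [hq.1]) hy h₂, Real.rpow_pos_of_pos hq.1 (-t₁)]

end Increment

/-! ### Negative moments. -/

section NegativeMoment

variable {Ω : Type*} [MeasurableSpace Ω] {P : Measure Ω} {f : Ω → ℝ} {t : ℝ}

theorem ae_pos_of_lintegral_rpow_neg (hf : Measurable f) (ht : 0 < t)
    (h : ∫⁻ ω, ENNReal.ofReal (f ω) ^ (-t) ∂P < ∞) : ∀ᵐ ω ∂P, 0 < f ω := by
  filter_upwards [ae_lt_top (by fun_prop) h.ne] with ω hω
  by_contra! hle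
  rw [ENNReal.ofReal_of_nonpos hle, ENNReal.zero_rpow_of_neg (neg_neg_of_pos ht)] at hω
  exact lt_irrefl _ hω

theorem integrable_rpow_neg_of_lintegral (hf : Measurable f) (ht : 0 < t)
    (h : ∫⁻ ω, ENNReal.ofReal (f ω) ^ (-t) ∂P < ∞) : Integrable (fun ω => f ω ^ (-t)) P := by
  have hpos := ae_pos_of_lintegral_rpow_neg hf ht h
  rw [← lintegral_ofReal_ne_top_iff_integrable (hf.pow_const _).aestronglyMeasurable
    (hpos.mono fun ω hω => (Real.rpow_pos_of_pos hω _).le)]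
  refine ne_of_lt ((lintegral_congr_ae ?_).trans_lt h)
  filter_upwards [hpos] with ω hω
  rw [ENNReal.ofReal_rpow_of_pos hω]

end NegativeMoment

/-! ### The mean increment in the random model and its zero. -/

namespace IsMoranModel

variable {Ω : Type*} [MeasurableSpace Ω] {P : Measure Ω} {A B : ℝ}
  {a b : ℕ → Ω → ℝ} {p : ℕ → Ω → unitInterval}

theorem isMoranRatios (h : IsMoranModel P A B a b p) (ω : Ω) :
    IsMoranRatios A B (fun n => a n ω) (fun n => b n ω) where
  A_pos := h.A_pos
  B_lt_one := h.B_lt_one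
  le_a n := (h.le_min n ω).trans (min_le_left _ _)
  le_b n := (h.le_min n ω).trans (min_le_right _ _)
  add_le n := h.add_le n ω

theorem a_mem_Ioo (h : IsMoranModel P A B a b p) (n : ℕ) (ω : Ω) : a n ω ∈ Ioo (0 : ℝ) 1 :=
  ⟨(h.isMoranRatios ω).a_pos n, ((h.isMoranRatios ω).a_le n).trans_lt h.B_lt_one⟩

theorem b_mem_Ioo (h : IsMoranModel P A B a b p) (n : ℕ) (ω : Ω) : b n ω ∈ Ioo (0 : ℝ) 1 :=
  ⟨(h.isMoranRatios ω).b_pos n, ((h.isMoranRatios ω).b_le n).trans_lt h.B_lt_one⟩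

theorem ae_p_mem_Ioo (h : IsMoranModel P A B a b p) :
    ∀ᵐ ω ∂P, ∀ n, (p n ω : ℝ) ∈ Ioo (0 : ℝ) 1 := by
  have hp0 := h.measurable_p 0
  obtain ⟨t₁, ht₁, h₁⟩ := h.moment_p
  obtain ⟨t₂, ht₂, h₂⟩ := h.moment_one_sub_p
  have h0 : ∀ᵐ ω ∂P, p 0 ω ∈ {u : unitInterval | (u : ℝ) ∈ Ioo (0 : ℝ) 1} := by
    filter_upwards [ae_pos_of_lintegral_rpow_neg (by fun_prop) ht₁ h₁,
      ae_pos_of_lintegral_rpow_neg (by fun_prop) ht₂ h₂] with ω hω₁ hω₂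
    exact ⟨hω₁, sub_pos.1 hω₂⟩
  rw [ae_all_iff]
  intro n
  exact (h.identDistrib_p n).symm.ae_mem_snd (measurable_subtype_coe measurableSet_Ioo) h0

theorem iIndepFun_triple (h : IsMoranModel P A B a b p) :
    iIndepFun (fun n ω => ((a n ω, b n ω), p n ω)) P :=
  iIndepFun.prodMk_of_indepFun (fun n => (h.measurable_a n).prodMk (h.measurable_b n))
    h.measurable_p h.indep_ab h.indep_p h.indep_ab_p

theorem measurable_incr (h : IsMoranModel P A B a b p) (θ : ℝ) (n : ℕ) :
    Measurable fun ω => moranIncr θ (a n ω) (b n ω) (p n ω) :=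
  (measurable_moranIncr θ).comp
    (((h.measurable_a n).prodMk (h.measurable_b n)).prodMk (h.measurable_p n))

theorem iIndepFun_incr (h : IsMoranModel P A B a b p) (θ : ℝ) :
    iIndepFun (fun n ω => moranIncr θ (a n ω) (b n ω) (p n ω)) P :=
  h.iIndepFun_triple.comp (fun _ u => moranIncr θ u.1.1 u.1.2 u.2)
    fun _ => measurable_moranIncr θ

theorem neg_log_B_pos (h : IsMoranModel P A B a b p) : 0 < -Real.log B :=
  neg_pos.2 (Real.log_neg (h.A_pos.trans h.A_lt_B) h.B_lt_one)

variable [IsProbabilityMeasure P]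

theorem identDistrib_triple (h : IsMoranModel P A B a b p) (n : ℕ) :
    IdentDistrib (fun ω => ((a n ω, b n ω), p n ω)) (fun ω => ((a 0 ω, b 0 ω), p 0 ω)) P P := by
  have hind : ∀ n, IndepFun (fun ω => (a n ω, b n ω)) (p n) P := fun n =>
    h.indep_ab_p.comp (measurable_pi_apply n) (measurable_pi_apply n)
  exact IdentDistrib.prodMk_of_indepFun (h.identDistrib_ab n) (h.identDistrib_p n) (hind n) (hind 0)

theorem identDistrib_incr (h : IsMoranModel P A B a b p) (θ : ℝ) (n : ℕ) :
    IdentDistrib (fun ω => moranIncr θ (a n ω) (b n ω) (p n ω))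
      (fun ω => moranIncr θ (a 0 ω) (b 0 ω) (p 0 ω)) P P :=
  (h.identDistrib_triple n).comp (measurable_moranIncr θ)

theorem zero_mem_interior_integrableExpSet_incr (h : IsMoranModel P A B a b p) {θ : ℝ}
    (hθ : 0 ≤ θ) :
    0 ∈ interior (integrableExpSet (fun ω => moranIncr θ (a 0 ω) (b 0 ω) (p 0 ω)) P) := by
  have hp0 := h.measurable_p 0
  have hmeas := h.measurable_incr θ 0
  obtain ⟨t₁, ht₁, h₁⟩ := h.moment_p
  obtain ⟨t₂, ht₂, h₂⟩ := h.moment_one_sub_p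
  rw [mem_interior_iff_mem_nhds]
  filter_upwards [Ioo_mem_nhds (neg_neg_of_pos (lt_min ht₁ ht₂)) one_pos] with s hs
  change Integrable (fun ω => Real.exp (s * moranIncr θ (a 0 ω) (b 0 ω) (p 0 ω))) P
  rcases le_total 0 s with hs0 | hs0
  -- For `s ≥ 0` the increment is bounded above by `-θ log A`, because `log p < 0`.
  · refine Integrable.of_bound (hmeas.const_mul s).exp.aestronglyMeasurable
      (Real.exp (s * (θ * -Real.log A))) ?_
    filter_upwards [h.ae_p_mem_Ioo] with ω hω
    rw [Real.norm_eq_abs, Real.abs_exp, Real.exp_le_exp]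
    refine mul_le_mul_of_nonneg_left ((min_le_left _ _).trans ?_) hs0
    have h3 := Real.log_le_log h.A_pos ((h.isMoranRatios ω).le_a 0)
    have h4 := Real.log_neg (hω 0).1 (hω 0).2
    nlinarith
  · refine ((integrable_rpow_neg_of_lintegral (by fun_prop) ht₁ h₁).add
      (integrable_rpow_neg_of_lintegral (by fun_prop) ht₂ h₂)).mono'
        (hmeas.const_mul s).exp.aestronglyMeasurable ?_
    filter_upwards [h.ae_p_mem_Ioo] with ω hω
    rw [Real.norm_eq_abs, Real.abs_exp]
    have hs' : -s < min t₁ t₂ := by linarith [hs.1]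
    simpa using exp_neg_mul_moranIncr_le hθ (h.a_mem_Ioo 0 ω) (h.b_mem_Ioo 0 ω) (hω 0)
      (neg_nonneg.2 hs0) (hs'.le.trans (min_le_left _ _)) (hs'.le.trans (min_le_right _ _))

/-- The case `θ = 0` follows from the exponential moments, and changing `θ` alters the increment by
a bounded amount. Negative `θ` are included because rationals below `α` may be negative. -/
theorem integrable_incr (h : IsMoranModel P A B a b p) (θ : ℝ) :
    Integrable (fun ω => moranIncr θ (a 0 ω) (b 0 ω) (p 0 ω)) P := by
  have h0 : Integrable (fun ω => moranIncr 0 (a 0 ω) (b 0 ω) (p 0 ω)) P :=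
    integrable_of_mem_interior_integrableExpSet (h.zero_mem_interior_integrableExpSet_incr le_rfl)
  have hmeas := h.measurable_incr θ 0
  refine (h0.norm.add (integrable_const (|θ| * -Real.log A))).mono' hmeas.aestronglyMeasurable
    (ae_of_all _ fun ω => ?_)
  have hω := h.isMoranRatios ω
  have hB : 0 < -Real.log B := neg_pos.2 (Real.log_neg hω.B_pos h.B_lt_one)
  simp only [Pi.add_apply, Real.norm_eq_abs]
  have h1 := neg_abs_le (moranIncr 0 (a 0 ω) (b 0 ω) (p 0 ω))
  have h2 := le_abs_self (moranIncr 0 (a 0 ω) (b 0 ω) (p 0 ω))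
  rcases le_total 0 θ with hθ | hθ
  · have h3 := moranIncr_add_le (q := p 0 ω) (hω.a_pos 0) (hω.b_pos 0) (hω.a_le 0) (hω.b_le 0) hθ
    have h4 := moranIncr_le_add (q := p 0 ω) h.A_pos (hω.le_a 0) (hω.le_b 0) hθ
    rw [abs_of_nonneg hθ, abs_le]
    constructor <;> nlinarith
  · have h3 := moranIncr_add_le (q := p 0 ω) (hω.a_pos 0) (hω.b_pos 0) (hω.a_le 0) (hω.b_le 0) hθ
    have h4 := moranIncr_le_add (q := p 0 ω) h.A_pos (hω.le_a 0) (hω.le_b 0) hθ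
    rw [abs_of_nonpos hθ, abs_le]
    constructor <;> nlinarith

theorem integral_incr_add_le (h : IsMoranModel P A B a b p) {θ θ' : ℝ} (hθ : θ ≤ θ') :
    ∫ ω, moranIncr θ (a 0 ω) (b 0 ω) (p 0 ω) ∂P + (θ' - θ) * (-Real.log B) ≤
      ∫ ω, moranIncr θ' (a 0 ω) (b 0 ω) (p 0 ω) ∂P := by
  calc _ = ∫ ω, (moranIncr θ (a 0 ω) (b 0 ω) (p 0 ω) + (θ' - θ) * (-Real.log B)) ∂P := by
        rw [integral_add (h.integrable_incr θ) (integrable_const _)]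
        simp
    _ ≤ _ := integral_mono ((h.integrable_incr θ).add (integrable_const _)) (h.integrable_incr θ')
        fun ω => moranIncr_add_le ((h.isMoranRatios ω).a_pos 0) ((h.isMoranRatios ω).b_pos 0)
          ((h.isMoranRatios ω).a_le 0) ((h.isMoranRatios ω).b_le 0) hθ

theorem integral_incr_le_add (h : IsMoranModel P A B a b p) {θ θ' : ℝ} (hθ : θ ≤ θ') :
    ∫ ω, moranIncr θ' (a 0 ω) (b 0 ω) (p 0 ω) ∂P ≤
      ∫ ω, moranIncr θ (a 0 ω) (b 0 ω) (p 0 ω) ∂P + (θ' - θ) * (-Real.log A) := by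
  calc _ ≤ ∫ ω, (moranIncr θ (a 0 ω) (b 0 ω) (p 0 ω) + (θ' - θ) * (-Real.log A)) ∂P :=
        integral_mono (h.integrable_incr θ') ((h.integrable_incr θ).add (integrable_const _))
          fun ω => moranIncr_le_add h.A_pos ((h.isMoranRatios ω).le_a 0)
            ((h.isMoranRatios ω).le_b 0) hθ
    _ = _ := by
        rw [integral_add (h.integrable_incr θ) (integrable_const _)]
        simp

theorem strictMono_integral_incr (h : IsMoranModel P A B a b p) :
    StrictMono fun θ => ∫ ω, moranIncr θ (a 0 ω) (b 0 ω) (p 0 ω) ∂P := by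
  intro θ θ' hθ
  have h1 := h.integral_incr_add_le hθ.le
  have h2 := mul_pos (sub_pos.2 hθ) h.neg_log_B_pos
  simp only
  linarith

theorem continuous_integral_incr (h : IsMoranModel P A B a b p) :
    Continuous fun θ => ∫ ω, moranIncr θ (a 0 ω) (b 0 ω) (p 0 ω) ∂P := by
  have hA : 0 ≤ -Real.log A :=
    neg_nonneg.2 (Real.log_nonpos h.A_pos.le (h.A_lt_B.trans h.B_lt_one).le)
  refine LipschitzWith.continuous (K := ⟨-Real.log A, hA⟩) (LipschitzWith.of_dist_le_mul ?_)
  have key : ∀ θ θ' : ℝ, θ ≤ θ' → dist (∫ ω, moranIncr θ (a 0 ω) (b 0 ω) (p 0 ω) ∂P)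
      (∫ ω, moranIncr θ' (a 0 ω) (b 0 ω) (p 0 ω) ∂P) ≤ -Real.log A * dist θ θ' := by
    intro θ θ' hθ
    have h1 := h.integral_incr_add_le hθ
    have h2 := h.integral_incr_le_add hθ
    have h3 := mul_nonneg (sub_nonneg.2 hθ) h.neg_log_B_pos.le
    rw [dist_comm, dist_comm θ, Real.dist_eq, Real.dist_eq, abs_of_nonneg (sub_nonneg.2 hθ),
      abs_of_nonneg (by linarith)]
    linarith
  intro θ θ'
  rcases le_total θ θ' with hθ | hθ
  · exact key θ θ' hθ
  · rw [dist_comm, dist_comm θ]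
    exact key θ' θ hθ

theorem exists_integral_incr_eq_zero (h : IsMoranModel P A B a b p) :
    ∃ α ≥ 0, ∫ ω, moranIncr α (a 0 ω) (b 0 ω) (p 0 ω) ∂P = 0 := by
  set m := fun θ => ∫ ω, moranIncr θ (a 0 ω) (b 0 ω) (p 0 ω) ∂P
  have hB := h.neg_log_B_pos
  have hm0 : m 0 ≤ 0 := by
    refine integral_nonpos_of_ae ?_
    filter_upwards [h.ae_p_mem_Ioo] with ω hω
    refine (min_le_left _ _).trans ?_
    simpa using (Real.log_neg (hω 0).1 (hω 0).2).le
  -- Growing at rate at least `-log B` from `m 0`, the mean is non-negative by this point.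
  set θ := -m 0 / -Real.log B
  have hθ : 0 ≤ θ := div_nonneg (neg_nonneg.2 hm0) hB.le
  have hm1 : 0 ≤ m θ := by
    have := h.integral_incr_add_le hθ
    rw [sub_zero, div_mul_cancel₀ _ hB.ne'] at this
    change m 0 + -m 0 ≤ m θ at this
    linarith
  obtain ⟨α, hα, hα0⟩ := intermediate_value_Icc hθ h.continuous_integral_incr.continuousOn
    (show (0 : ℝ) ∈ Icc (m 0) (m θ) from ⟨hm0, hm1⟩)
  exact ⟨α, hα.1, hα0⟩

/-- The sign of `G(θ) - θ` is opposite to that of the mean increment. -/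
theorem exists_neg_moranG_sub_eq_div (h : IsMoranModel P A B a b p)
    (hlog_p : Integrable (fun ω => Real.log (p 0 ω : ℝ)) P)
    (hlog_one_sub_p : Integrable (fun ω => Real.log (1 - (p 0 ω : ℝ))) P) (θ : ℝ) :
    ∃ z < 0, moranG P a b p θ - θ = (∫ ω, moranIncr θ (a 0 ω) (b 0 ω) (p 0 ω) ∂P) / z := by
  have ha := h.measurable_a 0
  have hb := h.measurable_b 0
  have hp := h.measurable_p 0
  have hset : MeasurableSet
      {ω | (p 0 ω : ℝ) ≤ a 0 ω ^ θ / (a 0 ω ^ θ + b 0 ω ^ θ)} :=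
    measurableSet_le (by fun_prop) (by fun_prop)
  have hY : Integrable (fun ω => moranY θ (a 0 ω) (b 0 ω) (p 0 ω)) P := by
    refine (hlog_p.norm.add hlog_one_sub_p.norm).mono'
      (Measurable.ite hset (by fun_prop) (by fun_prop)).aestronglyMeasurable
      (ae_of_all _ fun ω => ?_)
    simp only [Pi.add_apply, moranY]
    split_ifs
    · exact le_add_of_nonneg_right (norm_nonneg _)
    · exact le_add_of_nonneg_left (norm_nonneg _)
  have hZle : ∀ ω, moranZ θ (a 0 ω) (b 0 ω) (p 0 ω) ≤ Real.log B := by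
    intro ω
    have hω := h.isMoranRatios ω
    unfold moranZ
    split_ifs
    · exact Real.log_le_log (hω.a_pos 0) (hω.a_le 0)
    · exact Real.log_le_log (hω.b_pos 0) (hω.b_le 0)
  have hZge : ∀ ω, Real.log A ≤ moranZ θ (a 0 ω) (b 0 ω) (p 0 ω) := by
    intro ω
    have hω := h.isMoranRatios ω
    unfold moranZ
    split_ifs
    · exact Real.log_le_log h.A_pos (hω.le_a 0)
    · exact Real.log_le_log h.A_pos (hω.le_b 0)
  have hB := h.neg_log_B_pos
  have hZ : Integrable (fun ω => moranZ θ (a 0 ω) (b 0 ω) (p 0 ω)) P := by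
    refine Integrable.of_bound
      (Measurable.ite hset (by fun_prop) (by fun_prop)).aestronglyMeasurable (-Real.log A)
      (ae_of_all _ fun ω => ?_)
    rw [Real.norm_eq_abs, abs_le]
    constructor <;> linarith [hZle ω, hZge ω]
  have hz : ∫ ω, moranZ θ (a 0 ω) (b 0 ω) (p 0 ω) ∂P < 0 := by
    have := integral_mono hZ (integrable_const (Real.log B)) hZle
    simp only [integral_const, probReal_univ, one_smul] at this
    linarith
  refine ⟨_, hz, ?_⟩
  have heq : ∫ ω, moranIncr θ (a 0 ω) (b 0 ω) (p 0 ω) ∂P =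
      ∫ ω, moranY θ (a 0 ω) (b 0 ω) (p 0 ω) ∂P -
        θ * ∫ ω, moranZ θ (a 0 ω) (b 0 ω) (p 0 ω) ∂P := by
    rw [← integral_const_mul, ← integral_sub hY (hZ.const_mul θ)]
    refine integral_congr_ae ?_
    filter_upwards [h.ae_p_mem_Ioo] with ω hω
    exact (moranY_sub_moranZ (h.a_mem_Ioo 0 ω).1 (h.b_mem_Ioo 0 ω).1 (hω 0)).symm
  rw [heq, moranG, sub_div, mul_div_cancel_right₀ _ hz.ne]

theorem moranG_eq_iff (h : IsMoranModel P A B a b p)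
    (hlog_p : Integrable (fun ω => Real.log (p 0 ω : ℝ)) P)
    (hlog_one_sub_p : Integrable (fun ω => Real.log (1 - (p 0 ω : ℝ))) P) (θ : ℝ) :
    moranG P a b p θ = θ ↔ ∫ ω, moranIncr θ (a 0 ω) (b 0 ω) (p 0 ω) ∂P = 0 := by
  obtain ⟨z, hz, e⟩ := h.exists_neg_moranG_sub_eq_div hlog_p hlog_one_sub_p θ
  rw [← sub_eq_zero, e, div_eq_zero_iff, or_iff_left hz.ne]

theorem moranG_lt_iff (h : IsMoranModel P A B a b p)
    (hlog_p : Integrable (fun ω => Real.log (p 0 ω : ℝ)) P)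
    (hlog_one_sub_p : Integrable (fun ω => Real.log (1 - (p 0 ω : ℝ))) P) (θ : ℝ) :
    moranG P a b p θ < θ ↔ 0 < ∫ ω, moranIncr θ (a 0 ω) (b 0 ω) (p 0 ω) ∂P := by
  obtain ⟨z, hz, e⟩ := h.exists_neg_moranG_sub_eq_div hlog_p hlog_one_sub_p θ
  rw [← sub_neg, e, div_lt_iff_of_neg hz, zero_mul]

/-- The zero of the mean increment is almost surely the upper `Φ`-dimension of the Moran measure,
for all large dimension functions. -/
theorem ae_upperPhiDim_eq (h : IsMoranModel P A B a b p) {α : ℝ} (hα : 0 ≤ α)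
    (hα0 : ∫ ω, moranIncr α (a 0 ω) (b 0 ω) (p 0 ω) ∂P = 0) :
    ∀ᵐ ω ∂P, ∀ Φ : ℝ → ℝ, IsLargeDimensionFunction Φ →
      upperPhiDim Φ (moranMeasure (fun n => a n ω) (fun n => b n ω) (fun n => p n ω)) = α := by
  -- Countably many exponents, and events that do not involve `Φ`: the exceptional null set serves
  -- all dimension functions.
  have hlow : ∀ᵐ ω ∂P, ∀ q : ℚ, (q : ℝ) < α → Tendsto (fun n => ∑ i ∈ Finset.range n,
      moranIncr q (a i ω) (b i ω) (p i ω)) atTop atBot := by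
    refine ae_all_iff.2 fun q => ?_
    by_cases hq : (q : ℝ) < α
    · filter_upwards [ae_tendsto_sum_atBot (h.integrable_incr q) (h.iIndepFun_incr q)
        (h.identDistrib_incr q) ((h.strictMono_integral_incr hq).trans_eq hα0)] with ω hω _
      exact hω
    · exact ae_of_all _ fun _ hlt => absurd hlt hq
  have hupp : ∀ᵐ ω ∂P, ∀ q : ℚ, α < q → ∃ K > 0, ∃ N : ℕ, ∀ n ≥ N, ∀ k : ℕ,
      K * Real.log n ≤ k →
        0 ≤ ∑ i ∈ Finset.Ico n (n + k), moranIncr q (a i ω) (b i ω) (p i ω) := by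
    refine ae_all_iff.2 fun q => ?_
    by_cases hq : α < q
    · obtain ⟨K, hK, hae⟩ := ae_exists_forall_sum_Ico_nonneg (h.measurable_incr q)
        (h.iIndepFun_incr q) (h.identDistrib_incr q)
        (h.zero_mem_interior_integrableExpSet_incr (hα.trans hq.le))
        (hα0.symm.trans_lt (h.strictMono_integral_incr hq))
      filter_upwards [hae] with ω hω _
      exact ⟨K, hK, hω⟩
    · exact ae_of_all _ fun _ hlt => absurd hlt hq
  filter_upwards [h.ae_p_mem_Ioo, hlow, hupp] with ω hp hω₁ hω₂ Φ hΦ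
  have hr := h.isMoranRatios ω
  refine le_antisymm ?_ ?_
  · by_contra! hlt
    obtain ⟨q, hq1, hq2⟩ := EReal.lt_iff_exists_rat_btwn.1 hlt
    have hq1' : α < (q : ℝ) := EReal.coe_lt_coe_iff.1 hq1
    obtain ⟨K, hK, N, hN⟩ := hω₂ q hq1'
    exact hq2.not_ge (hr.upperPhiDim_le hp hΦ (hα.trans hq1'.le) hK hN)
  · by_contra! hlt
    obtain ⟨q, hq1, hq2⟩ := EReal.lt_iff_exists_rat_btwn.1 hlt
    have hq2' : (q : ℝ) < α := EReal.coe_lt_coe_iff.1 hq2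
    exact hq1.not_ge (hr.le_upperPhiDim hp hΦ.toIsDimensionFunction (hω₁ q hq2'))

end IsMoranModel

theorem mainTheorem4 {Ω : Type*} [MeasurableSpace Ω] (P : Measure Ω) [IsProbabilityMeasure P]
    (A B : ℝ) (a b : ℕ → Ω → ℝ) (p : ℕ → Ω → unitInterval) (hmodel : IsMoranModel P A B a b p)
    (hlog_p : Integrable (fun ω => Real.log (p 0 ω : ℝ)) P)
    (hlog_one_sub_p : Integrable (fun ω => Real.log (1 - (p 0 ω : ℝ))) P)
    (hG : ContinuousOn (moranG P a b p) (Ici 0)) :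
    (∃! α : ℝ, 0 ≤ α ∧ moranG P a b p α = α ∧ ∀ ψ, α < ψ → moranG P a b p ψ < ψ) ∧
      ∀ α : ℝ, (0 ≤ α ∧ moranG P a b p α = α ∧ ∀ ψ, α < ψ → moranG P a b p ψ < ψ) →
        ∀ᵐ ω ∂P, ∀ Φ : ℝ → ℝ, IsLargeDimensionFunction Φ →
          upperPhiDim Φ (moranMeasure (fun n => a n ω) (fun n => b n ω) (fun n => p n ω)) =
            (α : EReal) := by
  have hlt := hmodel.moranG_lt_iff hlog_p hlog_one_sub_p
  have heq := hmodel.moranG_eq_iff hlog_p hlog_one_sub_p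
  refine ⟨?_, fun α hα => hmodel.ae_upperPhiDim_eq hα.1 ((heq α).1 hα.2.1)⟩
  obtain ⟨α, hα, hα0⟩ := hmodel.exists_integral_incr_eq_zero
  refine ⟨α, ⟨hα, (heq α).2 hα0, fun ψ hψ => (hlt ψ).2 ?_⟩, fun β hβ => ?_⟩
  · exact hα0.symm.trans_lt (hmodel.strictMono_integral_incr hψ)
  · exact hmodel.strictMono_integral_incr.injective (((heq β).1 hβ.2.1).trans hα0.symm)
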